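/- Let $G$ be a connected (finite-dimensional, real) Lie group with unit $e$ and Lie algebra $\mathfrak g=T_eG$; $l_g$ denotes the left shift by $g$ and $\operatorname{Ad}(g)$ the differential of $h\mapsto ghg^{-1}$ at $e$. Let $\mathfrak p\subset\mathfrak g$ be a vector subspace that generates $\mathfrak g$ as a Lie algebra, $F$ a norm on $\mathfrak p$, and $U=\{u\in\mathfrak p: F(u)\le 1\}$; these data define a left-invariant (sub-)Finsler metric on $G$. For a tangent vector $X\in T_gG$ with $dl_{g^{-1}}X\in\mathfrak p$ put $|X|=F(dl_{g^{-1}}X)$; the length of a locally Lipschitz curve $g(t)$, $a\le t\le b$, with $dl_{g(t)^{-1}}\dot g(t)\in\mathfrak p$ for almost all $t$, is $\int_a^b|\dot g(t)|\,dt$. A locally Lipschitz curve $g:\mathbb R\to G$ is a *normal extremal* if it satisfies the Pontryagin maximum principle for the time-optimal problem of the control system $\dot g=dl_g(u)$, $u\in U$, with a positive value of the Hamiltonian: there are a measurable control $u:\mathbb R\to U$, a nowhere vanishing absolutely continuous covector function $\psi(t)\in T^*_{g(t)}G$ along $g$, and a constant $M_0>0$ such that for $H(g,\psi,u)=\psi(dl_g(u))$,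 at almost every $t$, $$\dot g=\frac{\partial H}{\partial\psi},\qquad \dot\psi=-\frac{\partial H}{\partial g},\qquad H(g(t),\psi(t),u(t))=\max_{u\in U}H(g(t),\psi(t),u)=M_0 .$$ Let $\psi_0\in\mathfrak g^*$ be a covector with $\max_{u\in U}\psi_0(u)=1$. For every $g\in G$ let $w(g)\in U$ be a vector with $$\psi_0(\operatorname{Ad}(g)(w(g)))=\max_{w\in U}\psi_0(\operatorname{Ad}(g)(w))$$ (any choice of maximizers is allowed), and define the geodesic vector field $$v(g)=dl_g(u(g)),\qquad u(g)=\psi_0(\operatorname{Ad}(g)(w(g)))\,w(g).$$ **Theorem.** Let $g_0\in G$ with $v(g_0)\ne 0$, and let $g:\mathbb R\to G$ be an integral curve of the vector field $v$ with $g(0)=g_0$, that is, a locally Lipschitz curve with $\dot g(t)=v(g(t))$ for almost all $t$. Then $g$ is a normal extremal parametrized proportionally to arc length with the proportionality factor $c=|dl_{g_0^{-1}}(v(g_0))|=F(dl_{g_0^{-1}}(v(g_0)))>0$. This means that the curve $s\mapsto g(s/c)$ is a normal extremal, and that the length of $g$ on $[a,b]$ equals $c\,(b-a)$ for all $a\le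 b$. -/

import Mathlib

open Set Filter Topology MeasureTheory
open scoped Manifold ContDiff ENNReal NNReal

noncomputable section

namespace SubFinsler

section Group

variable {E : Type*} [NormedAddCommGroup E] [NormedSpace ℝ E]
  {G : Type*} [TopologicalSpace G] [ChartedSpace E G] [Group G]

/-- The differential `(dl_q)_e : 𝔤 → T_q G` of the left shift `l_q`, as a continuous linear map. -/
def dLeft (q : G) : GroupLieAlgebra 𝓘(ℝ, E) G →L[ℝ] TangentSpace 𝓘(ℝ, E) q :=
  mfderiv 𝓘(ℝ, E) 𝓘(ℝ, E) (fun h : G => q * h) 1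

/-- The differential `(dl_{q⁻¹})_q : T_q G → 𝔤` of the left shift `l_{q⁻¹}`. -/
def dLeftInv (q : G) : TangentSpace 𝓘(ℝ, E) q →L[ℝ] GroupLieAlgebra 𝓘(ℝ, E) G :=
  mfderiv 𝓘(ℝ, E) 𝓘(ℝ, E) (fun h : G => q⁻¹ * h) q

/-- The adjoint representation: `Ad q` is the differential at `e` of `h ↦ q h q⁻¹`. -/
def Ad (q : G) : GroupLieAlgebra 𝓘(ℝ, E) G →L[ℝ] GroupLieAlgebra 𝓘(ℝ, E) G :=
  mfderiv 𝓘(ℝ, E) 𝓘(ℝ, E) (fun h : G => q * h * q⁻¹) 1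

/-- The powers of a subspace `p` of the Lie algebra under the bracket; `bracketPow p k` is
`p^{k+1}`, where `p^1 = p` and `p^{k+1} = [p, p^k]` (linear span of all brackets). -/
def bracketPow (p : Submodule ℝ (GroupLieAlgebra 𝓘(ℝ, E) G)) :
    ℕ → Submodule ℝ (GroupLieAlgebra 𝓘(ℝ, E) G)
  | 0 => p
  | k + 1 => Submodule.span ℝ {x | ∃ v ∈ p, ∃ w ∈ bracketPow p k, x = ⁅v, w⁆}

/-- The subspace `p` generates the Lie algebra: `p^1 + ⋯ + p^{m+1} = 𝔤` for some `m`. -/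
def Generates (p : Submodule ℝ (GroupLieAlgebra 𝓘(ℝ, E) G)) : Prop :=
  ∃ m : ℕ, (⨆ k ∈ Finset.range (m + 1), bracketPow p k) = ⊤

variable (E G) in
/-- The data of a left-invariant (sub-)Finsler metric on `G`: a subspace `p` of the Lie algebra
that generates it, and a norm `F` on `p` (a seminorm that vanishes only at zero). -/
structure LeftInvariantMetric where
  p : Submodule ℝ (GroupLieAlgebra 𝓘(ℝ, E) G)
  generates : Generates p
  F : Seminorm ℝ p
  eq_zero_of_F_eq_zero : ∀ x : p, F x = 0 → x = 0

namespace LeftInvariantMetric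

/-- The closed unit ball `U = {u ∈ p : F u ≤ 1}`, the control region, as a subset of `𝔤`. -/
def U (d : LeftInvariantMetric E G) : Set (GroupLieAlgebra 𝓘(ℝ, E) G) :=
  {u | ∃ h : u ∈ d.p, d.F ⟨u, h⟩ ≤ 1}

open Classical in
/-- The length `|X| = F (dl_{q⁻¹} X)` of a tangent vector `X ∈ T_q G`; it is `∞` if `X` is not
horizontal, that is, if `dl_{q⁻¹} X ∉ p`. -/
def tnorm (d : LeftInvariantMetric E G) (q : G) (X : TangentSpace 𝓘(ℝ, E) q) : ℝ≥0∞ :=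
  if h : dLeftInv q X ∈ d.p then ENNReal.ofReal (d.F ⟨dLeftInv q X, h⟩) else ∞

/-- The length `∫_a^b |ġ(t)| dt` of the restriction of the curve `g` to `[a, b]`. -/
def length (d : LeftInvariantMetric E G) (g : ℝ → G) (a b : ℝ) : ℝ≥0∞ :=
  ∫⁻ t in Icc a b, d.tnorm (g t) (mfderiv 𝓘(ℝ, ℝ) 𝓘(ℝ, E) g t (1 : ℝ))

end LeftInvariantMetric

/-- The curve `g` has the velocity `X ∈ T_{g(t)} G` at the time `t`. -/
def HasVelocityAt (g : ℝ → G) (t : ℝ) (X : TangentSpace 𝓘(ℝ, E) (g t)) : Prop :=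
  HasMFDerivAt 𝓘(ℝ, ℝ) 𝓘(ℝ, E) g t ((1 : ℝ →L[ℝ] ℝ).smulRight X)

variable (E) in
/-- The curve `g` is locally Lipschitz relative to the smooth structure of `G`: it is continuous
and its expression in the chart at `g t` is Lipschitz near `t`, for every `t`. -/
def LocallyLipschitzCurve (g : ℝ → G) : Prop :=
  ∀ t : ℝ, ContinuousAt g t ∧
    ∃ K : ℝ≥0, ∃ s ∈ 𝓝 t, LipschitzOnWith K (fun τ => extChartAt 𝓘(ℝ, E) (g t) (g τ)) s

/-- Lipschitz integral curves, defined on all of `ℝ`, of a vector field `v` on `G` (which need not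
be continuous): `ġ(t) = v(g(t))` for almost all `t`. -/
structure IsIntegralCurve (v : ∀ q : G, TangentSpace 𝓘(ℝ, E) q) (g : ℝ → G) : Prop where
  locallyLipschitz : LocallyLipschitzCurve E g
  velocity : ∀ᵐ t : ℝ, HasVelocityAt g t (v (g t))

/-! The Hamiltonian system of the control system `ġ = dl_g(u)`. -/

/-- The Hamiltonian `H(q, ξ, u) = ξ(dl_q(u))`, `ξ ∈ T*_q G`. -/
def hamiltonian (q : G) (ξ : TangentSpace 𝓘(ℝ, E) q →L[ℝ] ℝ) (u : GroupLieAlgebra 𝓘(ℝ, E) G) : ℝ :=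
  ξ (dLeft q u)

/-- The fibre coordinates of the covector `ξ ∈ T*_q G` that go with the local coordinates on `G`
given by the chart at `q₀`; `q` is in the domain of this chart. -/
def covectorCoord (q₀ q : G) (ξ : TangentSpace 𝓘(ℝ, E) q →L[ℝ] ℝ) : E →L[ℝ] ℝ :=
  let D : E →L[ℝ] TangentSpace 𝓘(ℝ, E) q :=
    mfderiv 𝓘(ℝ, E) 𝓘(ℝ, E) (extChartAt 𝓘(ℝ, E) q₀).symm (extChartAt 𝓘(ℝ, E) q₀ q)
  ξ.comp D

/-- The Hamiltonian in the canonical coordinates `(x, y)` on `T*G` over the chart at `q₀`. -/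
def hamiltonianCoord (q₀ : G) (u : GroupLieAlgebra 𝓘(ℝ, E) G) (x : E) (y : E →L[ℝ] ℝ) : ℝ :=
  let q : G := (extChartAt 𝓘(ℝ, E) q₀).symm x
  let D : TangentSpace 𝓘(ℝ, E) q →L[ℝ] E :=
    mfderiv 𝓘(ℝ, E) 𝓘(ℝ, E) (extChartAt 𝓘(ℝ, E) q₀) q
  hamiltonian q (y.comp D) u

/-- Hamilton's equations `ẋ = ∂H/∂y`, `ẏ = -∂H/∂x` at the time `t`, in the canonical coordinates
over the chart at `q₀`, for the curve `g`, the covectors `ξ t ∈ T*_{g(t)} G` along it and the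
control `u`. The vector `∂H/∂y` of `E` is given by its pairing with all `η` in the dual of `E`. -/
def HamiltonEquationsAt (g : ℝ → G) (ξ : ∀ t : ℝ, TangentSpace 𝓘(ℝ, E) (g t) →L[ℝ] ℝ)
    (u : ℝ → GroupLieAlgebra 𝓘(ℝ, E) G) (q₀ : G) (t : ℝ) : Prop :=
  let x : ℝ → E := fun τ => extChartAt 𝓘(ℝ, E) q₀ (g τ)
  let y : ℝ → E →L[ℝ] ℝ := fun τ => covectorCoord q₀ (g τ) (ξ τ)
  (∃ x' : E, HasDerivAt x x' t ∧
    ∀ η : E →L[ℝ] ℝ, η x' = fderiv ℝ (fun z => hamiltonianCoord q₀ (u t) (x t) z) (y t) η) ∧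
  HasDerivAt y (-(fderiv ℝ (fun z => hamiltonianCoord q₀ (u t) z (y t)) (x t))) t

/-- The Pontryagin maximum principle for the time-optimal problem of the control system
`ġ = dl_g(u)`, `u ∈ U`, with bounded measurable controls: `g` is the trajectory, `u` the control
and `ξ` the non-vanishing absolutely continuous covector function along `g`. (Absolute continuity
is expressed after identification of `T*_{g(t)} G` with `𝔤*` by left shifts.) -/
structure SatisfiesPMP (d : LeftInvariantMetric E G) (g : ℝ → G)
    (u : ℝ → GroupLieAlgebra 𝓘(ℝ, E) G)
    (ξ : ∀ t : ℝ, TangentSpace 𝓘(ℝ, E) (g t) →L[ℝ] ℝ) : Prop where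
  locallyLipschitz : LocallyLipschitzCurve E g
  measurable : AEStronglyMeasurable u volume
  mem_U : ∀ t : ℝ, u t ∈ d.U
  absolutelyContinuous : ∀ (v : GroupLieAlgebra 𝓘(ℝ, E) G) (a b : ℝ),
    AbsolutelyContinuousOnInterval (fun t => ξ t (dLeft (g t) v)) a b
  ne_zero : ∀ t : ℝ, ξ t ≠ 0
  hamilton : ∀ q₀ : G, ∀ᵐ t : ℝ, g t ∈ (extChartAt 𝓘(ℝ, E) q₀).source →
    HamiltonEquationsAt g ξ u q₀ t
  maximum : ∀ᵐ t : ℝ, ∀ w ∈ d.U, hamiltonian (g t) (ξ t) w ≤ hamiltonian (g t) (ξ t) (u t)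

/-- A normal extremal: a curve that satisfies the maximum principle with a Hamiltonian which is
constant along the curve and equal to some `M₀ > 0`. -/
def IsNormalExtremal (d : LeftInvariantMetric E G) (g : ℝ → G) : Prop :=
  ∃ (u : ℝ → GroupLieAlgebra 𝓘(ℝ, E) G) (ξ : ∀ t : ℝ, TangentSpace 𝓘(ℝ, E) (g t) →L[ℝ] ℝ)
    (M₀ : ℝ), 0 < M₀ ∧ SatisfiesPMP d g u ξ ∧ ∀ᵐ t : ℝ, hamiltonian (g t) (ξ t) (u t) = M₀

/-- `w : G → U` selects, for every `q`, a point of `U` at which `ψ₀ ∘ Ad q` attains its maximum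
on `U`. -/
def IsMaximalSelection (d : LeftInvariantMetric E G) (ψ₀ : GroupLieAlgebra 𝓘(ℝ, E) G →L[ℝ] ℝ)
    (w : G → GroupLieAlgebra 𝓘(ℝ, E) G) : Prop :=
  ∀ q : G, w q ∈ d.U ∧ ∀ w' ∈ d.U, ψ₀ (Ad q w') ≤ ψ₀ (Ad q (w q))

/-- The geodesic vector field `v(q) = dl_q(u(q))`, `u(q) = ψ₀(Ad(q) w(q)) w(q)`. -/
def geodesicField (ψ₀ : GroupLieAlgebra 𝓘(ℝ, E) G →L[ℝ] ℝ) (w : G → GroupLieAlgebra 𝓘(ℝ, E) G)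
    (q : G) : TangentSpace 𝓘(ℝ, E) q :=
  dLeft q (ψ₀ (Ad q (w q)) • w q)

end Group

end SubFinsler

end

/-! The covector function of the extremal is the restriction to the curve of the right-invariant
one-form with value `ψ₀` at the unit. Conjugation is a left shift followed by a right shift, so
pairing this form with `dl_q(u)` gives `ψ₀(Ad(q)u)`, and the choice of `w` is exactly the maximum
condition.

Left-invariant fields are the velocity fields of right shifts, and right shifts preserve
right-invariant forms. Hence the Lie derivative of the form along every left-invariant field
vanishes (`lieDeriv_rightForm`). In canonical coordinates this is the adjoint equation
(`HasVelocityAt.hamiltonEquationsAt`).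

It remains to see that the maximum `k(t)` of `ψ₀ ∘ Ad(g(t))` over `U` is constant, although `w` may
be discontinuous (`max_const`). As a support function of a bounded set, `k` is locally Lipschitz. At
a time `s` it is touched from below by `τ ↦ ψ₀(Ad(g(τ)) w(g(s)))`, whose derivative at `s` is zero
for almost every `s` because the velocity there is a multiple of `dl(w(g(s)))`. So `k' = 0` almost
everywhere and `k` is a constant `c`. Where `k` is positive, `w` has norm one; thus `v` has length
`c`, and slowing time by `c` leaves the admissible control `w`. -/

noncomputable section

namespace SubFinsler

/-! ### Lie derivative of an invariant one-form in a vector space. -/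

section Calculus

variable {E : Type*} [NormedAddCommGroup E] [NormedSpace ℝ E]

/-- If the one-form `θ` is preserved by the family of local maps `ρ (·, s)`, which is the identity
for `s = s₀`, then its Lie derivative along the velocity field of the family vanishes. -/
theorem lieDeriv_eq_zero_of_invariant {ρ : E × E → E} {θ : E → E →L[ℝ] ℝ} {x s₀ : E}
    (hρ : ContDiffAt ℝ 2 ρ (x, s₀)) (hθ : DifferentiableAt ℝ θ x)
    (h0 : ∀ᶠ z in 𝓝 x, ρ (z, s₀) = z)
    (hinv : ∀ᶠ s in 𝓝 s₀, (θ (ρ (x, s))).comp (fderiv ℝ (fun z => ρ (z, s)) x) = θ x)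
    (u η : E) :
    fderiv ℝ θ x (fderiv ℝ (fun s => ρ (x, s)) s₀ u) η
      + θ x (fderiv ℝ (fun z => fderiv ℝ (fun s => ρ (z, s)) s₀ u) x η) = 0 := by
  have hx0 : ρ (x, s₀) = x := h0.self_of_nhds
  have hdiff : ∀ᶠ p in 𝓝 (x, s₀), DifferentiableAt ℝ ρ p := by
    filter_upwards [hρ.eventually (by simp)] with p hp using hp.differentiableAt (by simp)
  have hs : ∀ᶠ s in 𝓝 s₀, DifferentiableAt ℝ ρ (x, s) :=
    (Continuous.tendsto (by fun_prop : Continuous fun s : E => (x, s)) s₀).eventually hdiff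
  have hz : ∀ᶠ z in 𝓝 x, DifferentiableAt ℝ ρ (z, s₀) :=
    (Continuous.tendsto (by fun_prop : Continuous fun z : E => (z, s₀)) x).eventually hdiff
  have partial_s (z s : E) (h : DifferentiableAt ℝ ρ (z, s)) :
      HasFDerivAt (fun s => ρ (z, s)) ((fderiv ℝ ρ (z, s)).comp (ContinuousLinearMap.inr ℝ E E)) s :=
    h.hasFDerivAt.comp s (hasFDerivAt_prodMk_right z s)
  have partial_z (z s : E) (h : DifferentiableAt ℝ ρ (z, s)) :
      HasFDerivAt (fun z => ρ (z, s)) ((fderiv ℝ ρ (z, s)).comp (ContinuousLinearMap.inl ℝ E E)) z :=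
    h.hasFDerivAt.comp z (hasFDerivAt_prodMk_left z s)
  have hQ : HasFDerivAt (fderiv ℝ ρ) (fderiv ℝ (fderiv ℝ ρ) (x, s₀)) (x, s₀) :=
    ((hρ.fderiv_right (m := 1) (by norm_num)).differentiableAt (by simp)).hasFDerivAt
  set Q := fderiv ℝ (fderiv ℝ ρ) (x, s₀) with hQdef
  -- The derivative in `s` of the `z`-differential becomes the derivative in `z` of the velocity
  -- field.
  have hsymm : Q (0, u) (η, 0) = Q (η, 0) (0, u) :=
    (hρ.isSymmSndFDerivAt (by simp)) (0, u) (η, 0)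
  have hid : fderiv ℝ ρ (x, s₀) (η, 0) = η := by
    have h1 := (partial_z x s₀ hdiff.self_of_nhds).fderiv
    have h2 : fderiv ℝ (fun z => ρ (z, s₀)) x = ContinuousLinearMap.id ℝ E := by
      rw [Filter.EventuallyEq.fderiv_eq (f := id) (h0.mono fun z hz => hz)]
      exact fderiv_id
    have := congrArg (fun L : E →L[ℝ] E => L η) (h1.symm.trans h2)
    simpa using this
  have hL : fderiv ℝ (fun s => ρ (x, s)) s₀ u = fderiv ℝ ρ (x, s₀) (0, u) := by
    rw [(partial_s x s₀ hdiff.self_of_nhds).fderiv]; simp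
  have hDL : fderiv ℝ (fun z => fderiv ℝ (fun s => ρ (z, s)) s₀ u) x η = Q (η, 0) (0, u) := by
    have he : (fun z => fderiv ℝ (fun s => ρ (z, s)) s₀ u) =ᶠ[𝓝 x]
        fun z => fderiv ℝ ρ (z, s₀) (0, u) := by
      filter_upwards [hz] with z hz
      rw [(partial_s z s₀ hz).fderiv]; simp
    have hc : HasFDerivAt (fun z => fderiv ℝ ρ (z, s₀))
        (Q.comp (ContinuousLinearMap.inl ℝ E E)) x :=
      hQ.comp x (hasFDerivAt_prodMk_left x s₀)
    rw [he.fderiv_eq, (hc.clm_apply (hasFDerivAt_const (0, u) x)).fderiv]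
    simp
  have hθ' : HasFDerivAt θ (fderiv ℝ θ x) (ρ (x, s₀)) := by rw [hx0]; exact hθ.hasFDerivAt
  have hc1 : HasFDerivAt (fun s => θ (ρ (x, s))) _ s₀ :=
    hθ'.comp s₀ (partial_s x s₀ hdiff.self_of_nhds)
  have hc2 : HasFDerivAt (fun s => fderiv ℝ ρ (x, s) (η, 0)) _ s₀ :=
    (hQ.comp s₀ (hasFDerivAt_prodMk_right x s₀)).clm_apply (hasFDerivAt_const (η, (0 : E)) s₀)
  have hprod := (hc1.clm_apply hc2).fderiv
  -- By invariance the pulled-back form does not depend on `s`; the product rule at `s₀` then yields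
  -- the two terms of the claim.
  have hconst : (fun s => θ (ρ (x, s)) (fderiv ℝ ρ (x, s) (η, 0))) =ᶠ[𝓝 s₀]
      fun _ => θ x η := by
    filter_upwards [hinv, hs] with s h1 h2
    rw [(partial_z x s h2).fderiv] at h1
    rw [← h1]; simp
  rw [hconst.fderiv_eq] at hprod
  have := congrArg (fun L : E →L[ℝ] ℝ => L u) hprod
  simp [hid, hx0] at this
  rw [hL, hDL, ← hsymm]
  linarith

end Calculus

/-! ### Shifts, right-invariant forms and left-invariant fields in charts. -/

section Charts

variable {E : Type*} [NormedAddCommGroup E] [NormedSpace ℝ E]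
  {G : Type*} [TopologicalSpace G] [ChartedSpace E G]

variable (E) in
/-- The derivative at `q` of the chart at `q₀`. -/
def chartDeriv (q₀ q : G) : E →L[ℝ] E := mfderiv 𝓘(ℝ, E) 𝓘(ℝ, E) (extChartAt 𝓘(ℝ, E) q₀) q

variable (E) in
/-- The derivative at `z` of the inverse of the chart at `q₀`. -/
def chartSymmDeriv (q₀ : G) (z : E) : E →L[ℝ] E :=
  mfderiv 𝓘(ℝ, E) 𝓘(ℝ, E) (extChartAt 𝓘(ℝ, E) q₀).symm z

section

variable [IsManifold 𝓘(ℝ, E) ∞ G]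

theorem contMDiffAt_chart {q₀ q : G} (hq : q ∈ (extChartAt 𝓘(ℝ, E) q₀).source) :
    ContMDiffAt 𝓘(ℝ, E) 𝓘(ℝ, E) ∞ (extChartAt 𝓘(ℝ, E) q₀) q :=
  contMDiffAt_extChartAt' (by rwa [extChartAt_source] at hq)

theorem contMDiffAt_chart_symm {q₀ : G} {z : E} (hz : z ∈ (extChartAt 𝓘(ℝ, E) q₀).target) :
    ContMDiffAt 𝓘(ℝ, E) 𝓘(ℝ, E) ∞ (extChartAt 𝓘(ℝ, E) q₀).symm z :=
  (contMDiffOn_extChartAt_symm q₀).contMDiffAt ((isOpen_extChartAt_target q₀).mem_nhds hz)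

theorem hasMFDerivAt_chart {q₀ q : G} (hq : q ∈ (extChartAt 𝓘(ℝ, E) q₀).source) :
    HasMFDerivAt 𝓘(ℝ, E) 𝓘(ℝ, E) (extChartAt 𝓘(ℝ, E) q₀) q (chartDeriv E q₀ q) :=
  ((contMDiffAt_chart hq).mdifferentiableAt (by simp)).hasMFDerivAt

theorem hasMFDerivAt_chart_symm {q₀ : G} {z : E} (hz : z ∈ (extChartAt 𝓘(ℝ, E) q₀).target) :
    HasMFDerivAt 𝓘(ℝ, E) 𝓘(ℝ, E) (extChartAt 𝓘(ℝ, E) q₀).symm z (chartSymmDeriv E q₀ z) :=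
  ((contMDiffAt_chart_symm hz).mdifferentiableAt (by simp)).hasMFDerivAt

theorem chartSymmDeriv_comp_chartDeriv {q₀ q : G}
    (hq : q ∈ (extChartAt 𝓘(ℝ, E) q₀).source) :
    (chartSymmDeriv E q₀ (extChartAt 𝓘(ℝ, E) q₀ q)).comp (chartDeriv E q₀ q) =
      ContinuousLinearMap.id ℝ E := by
  have h : HasMFDerivAt 𝓘(ℝ, E) 𝓘(ℝ, E)
      ((extChartAt 𝓘(ℝ, E) q₀).symm ∘ extChartAt 𝓘(ℝ, E) q₀) q
      ((chartSymmDeriv E q₀ (extChartAt 𝓘(ℝ, E) q₀ q)).comp (chartDeriv E q₀ q) : E →L[ℝ] E) :=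
    (hasMFDerivAt_chart_symm ((extChartAt 𝓘(ℝ, E) q₀).map_source hq)).comp q
      (hasMFDerivAt_chart hq)
  have h' : HasMFDerivAt 𝓘(ℝ, E) 𝓘(ℝ, E)
      ((extChartAt 𝓘(ℝ, E) q₀).symm ∘ extChartAt 𝓘(ℝ, E) q₀) q (ContinuousLinearMap.id ℝ E) := by
    refine (hasMFDerivAt_id q).congr_of_eventuallyEq ?_
    filter_upwards [(isOpen_extChartAt_source q₀).mem_nhds hq] with y hy
    exact (extChartAt 𝓘(ℝ, E) q₀).left_inv hy
  exact hasMFDerivAt_unique h h'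

/-- The tangent space at `q` is a copy of `E`, identified by means of the preferred chart at `q`
itself. -/
theorem chartDeriv_self (q : G) : chartDeriv E q q = ContinuousLinearMap.id ℝ E := by
  have : IsManifold 𝓘(ℝ, E) 1 G := IsManifold.of_le (n := ∞) (by simp)
  exact mfderiv_extChartAt_self (I := 𝓘(ℝ, E)) (x := q)

theorem chartSymmDeriv_self (q : G) :
    chartSymmDeriv E q (extChartAt 𝓘(ℝ, E) q q) = ContinuousLinearMap.id ℝ E := by
  have h := chartSymmDeriv_comp_chartDeriv (mem_extChartAt_source (I := 𝓘(ℝ, E)) q)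
  rwa [chartDeriv_self, ContinuousLinearMap.comp_id] at h

end

variable [Group G]

variable (E) in
/-- The differential of the left shift by `q` at the unit. -/
def leftDeriv (q : G) : E →L[ℝ] E := dLeft (E := E) q

variable (E) in
/-- The differential of the right shift by `p` at `q`. -/
def rightDeriv (p q : G) : E →L[ℝ] E := mfderiv 𝓘(ℝ, E) 𝓘(ℝ, E) (fun h : G => h * p) q

/-- The right-invariant one-form on `G` with value `ψ` at the unit. -/
def rightForm (ψ : E →L[ℝ] ℝ) (q : G) : E →L[ℝ] ℝ := ψ.comp (rightDeriv E q⁻¹ q)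

/-- The right-invariant one-form on `G` with value `ψ` at the unit, in the chart at `q₀`. -/
def rightFormCoord (ψ : E →L[ℝ] ℝ) (q₀ : G) (z : E) : E →L[ℝ] ℝ :=
  (rightForm ψ ((extChartAt 𝓘(ℝ, E) q₀).symm z)).comp (chartSymmDeriv E q₀ z)

variable (E) in
/-- The left-invariant vector fields in the chart at `q₀`. -/
def leftFieldCoord (q₀ : G) (z : E) : E →L[ℝ] E :=
  (chartDeriv E q₀ ((extChartAt 𝓘(ℝ, E) q₀).symm z)).comp
    (leftDeriv E ((extChartAt 𝓘(ℝ, E) q₀).symm z))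

variable (E) in
/-- Multiplication in the charts at `q₀` and at the unit. -/
def mulCoord (q₀ : G) (p : E × E) : E :=
  extChartAt 𝓘(ℝ, E) q₀
    ((extChartAt 𝓘(ℝ, E) q₀).symm p.1 * (extChartAt 𝓘(ℝ, E) (1 : G)).symm p.2)

/-- The covector `ψ ∘ Ad q`. -/
def adDual (ψ : E →L[ℝ] ℝ) (q : G) : E →L[ℝ] ℝ := ψ.comp (Ad (E := E) q)

variable [LieGroup 𝓘(ℝ, E) ∞ G]

theorem hasMFDerivAt_left (q : G) :
    HasMFDerivAt 𝓘(ℝ, E) 𝓘(ℝ, E) (fun h : G => q * h) 1 (leftDeriv E q) :=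
  (contMDiff_mul_left (I := 𝓘(ℝ, E)) (n := ∞).mdifferentiableAt (by simp)).hasMFDerivAt

theorem hasMFDerivAt_leftInv (q : G) :
    HasMFDerivAt 𝓘(ℝ, E) 𝓘(ℝ, E) (fun h : G => q⁻¹ * h) q (dLeftInv (E := E) q) :=
  (contMDiff_mul_left (I := 𝓘(ℝ, E)) (n := ∞).mdifferentiableAt (by simp)).hasMFDerivAt

theorem hasMFDerivAt_right (p q : G) :
    HasMFDerivAt 𝓘(ℝ, E) 𝓘(ℝ, E) (fun h : G => h * p) q (rightDeriv E p q) :=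
  (contMDiff_mul_right (I := 𝓘(ℝ, E)) (n := ∞).mdifferentiableAt (by simp)).hasMFDerivAt

theorem dLeftInv_dLeft (q : G) (u : GroupLieAlgebra 𝓘(ℝ, E) G) : dLeftInv q (dLeft q u) = u := by
  -- The point `q * 1` is not definitionally `q`, so the base point is generalized before the chain
  -- rule.
  have h0 (q' : G) (hq' : q' = q) : HasMFDerivAt 𝓘(ℝ, E) 𝓘(ℝ, E) (fun h : G => q⁻¹ * h) q'
      (show E →L[ℝ] E from dLeftInv (E := E) q) := by
    subst hq'
    exact hasMFDerivAt_leftInv q'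
  have h : HasMFDerivAt 𝓘(ℝ, E) 𝓘(ℝ, E) ((fun h : G => q⁻¹ * h) ∘ fun h : G => q * h) 1 _ :=
    (h0 _ (mul_one q)).comp (1 : G) (hasMFDerivAt_left q)
  have h' : ((fun h : G => q⁻¹ * h) ∘ fun h : G => q * h) = id := by ext; simp
  rw [h'] at h
  exact congrArg (fun L : E →L[ℝ] E => L u) (hasMFDerivAt_unique h (hasMFDerivAt_id (1 : G)))

theorem adDual_eq (ψ : E →L[ℝ] ℝ) (q : G) :
    adDual ψ q = (rightForm ψ q).comp (leftDeriv E q) := by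
  have h0 (q' : G) (hq' : q' = q) : HasMFDerivAt 𝓘(ℝ, E) 𝓘(ℝ, E) (fun h : G => h * q⁻¹) q'
      (rightDeriv E q⁻¹ q) := by
    subst hq'
    exact hasMFDerivAt_right q'⁻¹ q'
  have h : HasMFDerivAt 𝓘(ℝ, E) 𝓘(ℝ, E) ((fun h : G => h * q⁻¹) ∘ fun h : G => q * h) 1
      ((rightDeriv E q⁻¹ q).comp (leftDeriv E q) : E →L[ℝ] E) :=
    (h0 _ (mul_one q)).comp (1 : G) (hasMFDerivAt_left q)
  have h2 : Ad (E := E) q = ((rightDeriv E q⁻¹ q).comp (leftDeriv E q) : E →L[ℝ] E) := h.mfderiv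
  rw [adDual, h2, rightForm, ContinuousLinearMap.comp_assoc]

/-- Right shift by `h` followed by right shift by `(q * h)⁻¹` is right shift by `q⁻¹`. -/
theorem rightForm_comp_rightDeriv (ψ : E →L[ℝ] ℝ) (q h : G) :
    (rightForm ψ (q * h)).comp (rightDeriv E h q) = rightForm ψ q := by
  have h1 : HasMFDerivAt 𝓘(ℝ, E) 𝓘(ℝ, E) ((fun p : G => p * (q * h)⁻¹) ∘ fun p => p * h) q
      ((rightDeriv E (q * h)⁻¹ (q * h)).comp (rightDeriv E h q) : E →L[ℝ] E) :=
    (hasMFDerivAt_right (q * h)⁻¹ (q * h)).comp q (hasMFDerivAt_right h q)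
  have h' : ((fun p : G => p * (q * h)⁻¹) ∘ fun p => p * h) = fun p => p * q⁻¹ := by
    ext; simp [mul_assoc]
  rw [h'] at h1
  have := hasMFDerivAt_unique h1 (hasMFDerivAt_right q⁻¹ q)
  rw [rightForm, rightForm, ContinuousLinearMap.comp_assoc]
  exact congrArg ψ.comp this

theorem adDual_eq_coord (ψ : E →L[ℝ] ℝ) {q₀ q : G} (hq : q ∈ (extChartAt 𝓘(ℝ, E) q₀).source) :
    adDual ψ q = (rightFormCoord ψ q₀ (extChartAt 𝓘(ℝ, E) q₀ q)).comp
      (leftFieldCoord E q₀ (extChartAt 𝓘(ℝ, E) q₀ q)) := by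
  have h := chartSymmDeriv_comp_chartDeriv hq
  rw [rightFormCoord, leftFieldCoord, (extChartAt 𝓘(ℝ, E) q₀).left_inv hq, adDual_eq,
    ContinuousLinearMap.comp_assoc, ← (chartSymmDeriv E q₀ _).comp_assoc, h,
    ContinuousLinearMap.id_comp]

end Charts

/-! ### Smoothness in charts and invariance under right shifts. -/

section Invariance

theorem two_le_infty : (2 : WithTop ℕ∞) ≤ ((⊤ : ℕ∞) : WithTop ℕ∞) :=
  WithTop.coe_le_coe.2 (le_top : (2 : ℕ∞) ≤ ⊤)

variable {E : Type*} [NormedAddCommGroup E] [NormedSpace ℝ E]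

theorem hasMFDerivAt_comp_of_eq {M₁ M₂ M₃ : Type*} [TopologicalSpace M₁] [ChartedSpace E M₁]
    [TopologicalSpace M₂] [ChartedSpace E M₂] [TopologicalSpace M₃] [ChartedSpace E M₃]
    {f₁ : M₁ → M₂} {f₂ : M₂ → M₃} {x : M₁} {y : M₂} {L₁ L₂ : E →L[ℝ] E}
    (h₂ : HasMFDerivAt 𝓘(ℝ, E) 𝓘(ℝ, E) f₂ y L₂) (h₁ : HasMFDerivAt 𝓘(ℝ, E) 𝓘(ℝ, E) f₁ x L₁)
    (h : f₁ x = y) :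
    HasMFDerivAt 𝓘(ℝ, E) 𝓘(ℝ, E) (f₂ ∘ f₁) x (L₂.comp L₁ : E →L[ℝ] E) := by
  subst h
  exact h₂.comp x h₁

variable {G : Type*} [TopologicalSpace G] [ChartedSpace E G] [Group G] [LieGroup 𝓘(ℝ, E) ∞ G]

theorem contDiffAt_mulCoord {q₀ : G} {z s : E} (hz : z ∈ (extChartAt 𝓘(ℝ, E) q₀).target)
    (hs : s ∈ (extChartAt 𝓘(ℝ, E) (1 : G)).target)
    (hzs : (extChartAt 𝓘(ℝ, E) q₀).symm z * (extChartAt 𝓘(ℝ, E) (1 : G)).symm s ∈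
      (extChartAt 𝓘(ℝ, E) q₀).source) :
    ContDiffAt ℝ ∞ (mulCoord E q₀) (z, s) := by
  have h1 : ContMDiffAt 𝓘(ℝ, E × E) 𝓘(ℝ, E) ∞
      (fun p : E × E => (extChartAt 𝓘(ℝ, E) q₀).symm p.1) (z, s) :=
    (contMDiffAt_chart_symm hz).comp (z, s) contDiffAt_fst.contMDiffAt
  have h2 : ContMDiffAt 𝓘(ℝ, E × E) 𝓘(ℝ, E) ∞
      (fun p : E × E => (extChartAt 𝓘(ℝ, E) (1 : G)).symm p.2) (z, s) :=
    (contMDiffAt_chart_symm hs).comp (z, s) contDiffAt_snd.contMDiffAt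
  exact ((contMDiffAt_chart hzs).comp (z, s) (h1.mul h2)).contDiffAt

theorem hasFDerivAt_mulCoord_left {q₀ : G} {z s : E} (hz : z ∈ (extChartAt 𝓘(ℝ, E) q₀).target)
    (hzs : (extChartAt 𝓘(ℝ, E) q₀).symm z * (extChartAt 𝓘(ℝ, E) (1 : G)).symm s ∈
      (extChartAt 𝓘(ℝ, E) q₀).source) :
    HasFDerivAt (fun z => mulCoord E q₀ (z, s))
      ((chartDeriv E q₀
        ((extChartAt 𝓘(ℝ, E) q₀).symm z * (extChartAt 𝓘(ℝ, E) (1 : G)).symm s)).comp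
        ((rightDeriv E ((extChartAt 𝓘(ℝ, E) (1 : G)).symm s)
          ((extChartAt 𝓘(ℝ, E) q₀).symm z)).comp (chartSymmDeriv E q₀ z))) z :=
  (hasMFDerivAt_comp_of_eq (hasMFDerivAt_chart hzs)
    (hasMFDerivAt_comp_of_eq (hasMFDerivAt_right ((extChartAt 𝓘(ℝ, E) (1 : G)).symm s) _)
      (hasMFDerivAt_chart_symm hz) rfl) rfl).hasFDerivAt

/-- This exhibits the left-invariant fields as velocity fields of the family of right shifts, whose
parameter is the chart coordinate of the group element. -/
theorem hasFDerivAt_mulCoord_right {q₀ : G} {z : E} (hz : z ∈ (extChartAt 𝓘(ℝ, E) q₀).target) :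
    HasFDerivAt (fun s => mulCoord E q₀ (z, s)) (leftFieldCoord E q₀ z)
      (extChartAt 𝓘(ℝ, E) (1 : G) 1) := by
  have hsymm : (extChartAt 𝓘(ℝ, E) (1 : G)).symm (extChartAt 𝓘(ℝ, E) (1 : G) 1) = 1 :=
    extChartAt_to_inv 1
  have h := (hasMFDerivAt_comp_of_eq
    (hasMFDerivAt_chart ((extChartAt 𝓘(ℝ, E) q₀).map_target hz))
    (hasMFDerivAt_comp_of_eq (hasMFDerivAt_left ((extChartAt 𝓘(ℝ, E) q₀).symm z))
      (hasMFDerivAt_chart_symm (mem_extChartAt_target (I := 𝓘(ℝ, E)) (1 : G))) hsymm)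
      (by simp)).hasFDerivAt
  rw [chartSymmDeriv_self, ContinuousLinearMap.comp_id] at h
  exact h

theorem contDiffAt_leftFieldCoord {q₀ : G} {z : E}
    (hz : z ∈ (extChartAt 𝓘(ℝ, E) q₀).target) : ContDiffAt ℝ 1 (leftFieldCoord E q₀) z := by
  have hsymm : (extChartAt 𝓘(ℝ, E) (1 : G)).symm (extChartAt 𝓘(ℝ, E) (1 : G) 1) = 1 :=
    extChartAt_to_inv 1
  have h : ContDiffAt ℝ 1 (fun z => fderiv ℝ (fun s => mulCoord E q₀ (z, s))
      (extChartAt 𝓘(ℝ, E) (1 : G) 1)) z :=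
    ContDiffAt.fderiv (n := 2) (f := fun z s => mulCoord E q₀ (z, s))
      (g := fun _ => extChartAt 𝓘(ℝ, E) (1 : G) 1)
      ((contDiffAt_mulCoord hz (mem_extChartAt_target (I := 𝓘(ℝ, E)) (1 : G)) (by
        rw [hsymm, mul_one]; exact (extChartAt 𝓘(ℝ, E) q₀).map_target hz)).of_le two_le_infty)
      contDiffAt_const (by norm_num)
  refine h.congr_of_eventuallyEq ?_
  filter_upwards [(isOpen_extChartAt_target q₀).mem_nhds hz] with y hy
  exact (hasFDerivAt_mulCoord_right hy).fderiv.symm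

theorem contDiffAt_rightFormCoord (ψ : E →L[ℝ] ℝ) {q₀ : G} {z : E}
    (hz : z ∈ (extChartAt 𝓘(ℝ, E) q₀).target) : ContDiffAt ℝ 1 (rightFormCoord ψ q₀) z := by
  -- The form at `z` is `ψ` composed with the derivative in `z'`, at `z' = z`, of the quotient `z'
  -- z⁻¹` in the chart at the unit. With `z` as a parameter, smoothness in both variables gives
  -- smoothness of the form.
  have hsmooth : ContDiffAt ℝ ∞ (fun p : E × E => extChartAt 𝓘(ℝ, E) (1 : G)
      ((extChartAt 𝓘(ℝ, E) q₀).symm p.2 * ((extChartAt 𝓘(ℝ, E) q₀).symm p.1)⁻¹)) (z, z) := by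
    have h1 : ContMDiffAt 𝓘(ℝ, E × E) 𝓘(ℝ, E) ∞
        (fun p : E × E => (extChartAt 𝓘(ℝ, E) q₀).symm p.1) (z, z) :=
      (contMDiffAt_chart_symm hz).comp (z, z) contDiffAt_fst.contMDiffAt
    have h2 : ContMDiffAt 𝓘(ℝ, E × E) 𝓘(ℝ, E) ∞
        (fun p : E × E => (extChartAt 𝓘(ℝ, E) q₀).symm p.2) (z, z) :=
      (contMDiffAt_chart_symm hz).comp (z, z) contDiffAt_snd.contMDiffAt
    exact ((contMDiffAt_chart (by simp)).comp (z, z) (h2.mul h1.inv)).contDiffAt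
  have h : ContDiffAt ℝ 1 (fun z => ψ.comp (fderiv ℝ (fun z' => extChartAt 𝓘(ℝ, E) (1 : G)
      ((extChartAt 𝓘(ℝ, E) q₀).symm z' * ((extChartAt 𝓘(ℝ, E) q₀).symm z)⁻¹)) z)) z :=
    contDiffAt_const.clm_comp
      (ContDiffAt.fderiv (n := 2) (f := fun z z' => extChartAt 𝓘(ℝ, E) (1 : G)
        ((extChartAt 𝓘(ℝ, E) q₀).symm z' * ((extChartAt 𝓘(ℝ, E) q₀).symm z)⁻¹))
        (g := fun z => z)
        (hsmooth.of_le two_le_infty) contDiffAt_id (by norm_num))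
  refine h.congr_of_eventuallyEq ?_
  filter_upwards [(isOpen_extChartAt_target q₀).mem_nhds hz] with y hy
  have h : HasFDerivAt (fun z' => extChartAt 𝓘(ℝ, E) (1 : G)
      ((extChartAt 𝓘(ℝ, E) q₀).symm z' * ((extChartAt 𝓘(ℝ, E) q₀).symm y)⁻¹))
      ((chartDeriv E (1 : G) 1).comp ((rightDeriv E ((extChartAt 𝓘(ℝ, E) q₀).symm y)⁻¹
        ((extChartAt 𝓘(ℝ, E) q₀).symm y)).comp (chartSymmDeriv E q₀ y))) y :=
    (hasMFDerivAt_comp_of_eq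
      (hasMFDerivAt_chart (mem_extChartAt_source (I := 𝓘(ℝ, E)) (1 : G)))
      (hasMFDerivAt_comp_of_eq (hasMFDerivAt_right ((extChartAt 𝓘(ℝ, E) q₀).symm y)⁻¹ _)
        (hasMFDerivAt_chart_symm hy) rfl) (by simp)).hasFDerivAt
  rw [chartDeriv_self, ContinuousLinearMap.id_comp] at h
  rw [rightFormCoord, rightForm, ContinuousLinearMap.comp_assoc, h.fderiv]

/-- Right-invariant one-forms are preserved by the flows of left-invariant vector fields. -/
theorem lieDeriv_rightForm (ψ : E →L[ℝ] ℝ) {q₀ : G} {z : E}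
    (hz : z ∈ (extChartAt 𝓘(ℝ, E) q₀).target) (u η : E) :
    fderiv ℝ (rightFormCoord ψ q₀) z (leftFieldCoord E q₀ z u) η
      + rightFormCoord ψ q₀ z (fderiv ℝ (fun y => leftFieldCoord E q₀ y u) z η) = 0 := by
  have hsymm : (extChartAt 𝓘(ℝ, E) (1 : G)).symm (extChartAt 𝓘(ℝ, E) (1 : G) 1) = 1 :=
    extChartAt_to_inv 1
  have hs₀ := mem_extChartAt_target (I := 𝓘(ℝ, E)) (1 : G)
  have hzq := (extChartAt 𝓘(ℝ, E) q₀).map_target hz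
  have hzs : (extChartAt 𝓘(ℝ, E) q₀).symm z * (extChartAt 𝓘(ℝ, E) (1 : G)).symm
      (extChartAt 𝓘(ℝ, E) (1 : G) 1) ∈ (extChartAt 𝓘(ℝ, E) q₀).source := by
    rwa [hsymm, mul_one]
  have hnear := (isOpen_extChartAt_target q₀).mem_nhds hz
  have key := lieDeriv_eq_zero_of_invariant (ρ := mulCoord E q₀) (θ := rightFormCoord ψ q₀)
    ((contDiffAt_mulCoord hz hs₀ hzs).of_le two_le_infty)
    ((contDiffAt_rightFormCoord ψ hz).differentiableAt (by simp)) ?_ ?_ u η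
  · rw [(hasFDerivAt_mulCoord_right hz).fderiv] at key
    have he : (fun y => fderiv ℝ (fun s => mulCoord E q₀ (y, s)) (extChartAt 𝓘(ℝ, E) (1 : G) 1) u)
        =ᶠ[𝓝 z] fun y => leftFieldCoord E q₀ y u := by
      filter_upwards [hnear] with y hy
      rw [(hasFDerivAt_mulCoord_right hy).fderiv]
    rwa [he.fderiv_eq] at key
  · filter_upwards [hnear] with y hy
    simp only [mulCoord, hsymm, mul_one]
    exact (extChartAt 𝓘(ℝ, E) q₀).right_inv hy
  -- For `s` near the unit the product stays in the chart at `q₀`; the chart derivatives cancel and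
  -- right-invariance remains.
  · have hcont : ContinuousAt (fun s => (extChartAt 𝓘(ℝ, E) q₀).symm z *
        (extChartAt 𝓘(ℝ, E) (1 : G)).symm s) (extChartAt 𝓘(ℝ, E) (1 : G) 1) :=
      ((contMDiff_mul_left (I := 𝓘(ℝ, E)) (n := ∞)).continuous.continuousAt).comp
        (contMDiffAt_chart_symm hs₀).continuousAt
    filter_upwards [hcont.preimage_mem_nhds ((isOpen_extChartAt_source q₀).mem_nhds hzs)] with s hs
    have hs' : (extChartAt 𝓘(ℝ, E) q₀).symm z * (extChartAt 𝓘(ℝ, E) (1 : G)).symm s ∈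
      (extChartAt 𝓘(ℝ, E) q₀).source := hs
    rw [(hasFDerivAt_mulCoord_left hz hs').fderiv, rightFormCoord, rightFormCoord]
    simp only [mulCoord]
    rw [(extChartAt 𝓘(ℝ, E) q₀).left_inv hs']
    have h := chartSymmDeriv_comp_chartDeriv hs'
    simp only [ContinuousLinearMap.comp_assoc]
    rw [← (chartSymmDeriv E q₀ _).comp_assoc, h, ContinuousLinearMap.id_comp,
      ← ContinuousLinearMap.comp_assoc, rightForm_comp_rightDeriv]

end Invariance

/-! ### Derivatives and regularity along curves. -/

section Curves

variable {E : Type*} [NormedAddCommGroup E] [NormedSpace ℝ E]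
  {G : Type*} [TopologicalSpace G] [ChartedSpace E G]

theorem LocallyLipschitzCurve.continuous {g : ℝ → G} (hg : LocallyLipschitzCurve E g) :
    Continuous g :=
  continuous_iff_continuousAt.2 fun t => (hg t).1

theorem LocallyLipschitzCurve.comp_div {g : ℝ → G} (hg : LocallyLipschitzCurve E g) (c : ℝ) :
    LocallyLipschitzCurve E fun s => g (s / c) := by
  intro s
  obtain ⟨hc, K, S, hS, hK⟩ := hg (s / c)
  have hdiv : ContinuousAt (fun s : ℝ => s / c) s := by fun_prop
  refine ⟨ContinuousAt.comp (f := fun s : ℝ => s / c) hc hdiv, K * ‖c⁻¹‖₊,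
    (fun s : ℝ => s / c) ⁻¹' S, hdiv.preimage_mem_nhds hS, ?_⟩
  refine hK.comp (f := fun s : ℝ => s / c) (LipschitzWith.lipschitzOnWith ?_) (mapsTo_preimage _ _)
  refine LipschitzWith.of_dist_le_mul fun x y => ?_
  rw [Real.dist_eq, Real.dist_eq, ← sub_div, div_eq_inv_mul, abs_mul, coe_nnnorm, Real.norm_eq_abs]

theorem HasVelocityAt.comp_div {g : ℝ → G} {s c : ℝ} {X : E}
    (hg : HasVelocityAt g (s / c) X) : HasVelocityAt (fun s => g (s / c)) s (c⁻¹ • X) := by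
  have h1 : HasFDerivAt (fun s : ℝ => s / c) ((1 : ℝ →L[ℝ] ℝ).smulRight (c⁻¹ : ℝ)) s := by
    have := (hasDerivAt_id s).div_const c
    rw [one_div] at this
    exact this.hasFDerivAt
  have hg' : HasMFDerivAt 𝓘(ℝ, ℝ) 𝓘(ℝ, E) g (s / c)
      ((1 : ℝ →L[ℝ] ℝ).smulRight X) := hg
  have h2 : HasMFDerivAt 𝓘(ℝ, ℝ) 𝓘(ℝ, E) (fun s => g (s / c)) s
      (((1 : ℝ →L[ℝ] ℝ).smulRight X).comp
        ((1 : ℝ →L[ℝ] ℝ).smulRight (c⁻¹ : ℝ)) : ℝ →L[ℝ] E) :=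
    HasMFDerivAt.comp (f := fun s : ℝ => s / c) s hg' h1.hasMFDerivAt
  have h3 : ((1 : ℝ →L[ℝ] ℝ).smulRight X).comp
      ((1 : ℝ →L[ℝ] ℝ).smulRight (c⁻¹ : ℝ)) =
      (1 : ℝ →L[ℝ] ℝ).smulRight (c⁻¹ • X) := by
    ext; simp
  rw [h3] at h2
  exact h2

theorem HasVelocityAt.hasDerivAt_comp {g : ℝ → G} {t : ℝ} {X : E}
    (hg : HasVelocityAt g t X) {f : G → E} {L : E →L[ℝ] E}
    (hf : HasMFDerivAt 𝓘(ℝ, E) 𝓘(ℝ, E) f (g t) L) :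
    HasDerivAt (fun τ => f (g τ)) (L X) t := by
  have hg' : HasMFDerivAt 𝓘(ℝ, ℝ) 𝓘(ℝ, E) g t
      ((1 : ℝ →L[ℝ] ℝ).smulRight X) := hg
  have h : HasMFDerivAt 𝓘(ℝ, ℝ) 𝓘(ℝ, E) (fun τ => f (g τ)) t
      (L.comp ((1 : ℝ →L[ℝ] ℝ).smulRight X) : ℝ →L[ℝ] E) :=
    HasMFDerivAt.comp t hf hg'
  have h' : HasFDerivAt (fun τ => f (g τ))
      (L.comp ((1 : ℝ →L[ℝ] ℝ).smulRight X)) t := h.hasFDerivAt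
  refine h'.hasDerivAt.congr_deriv ?_
  simp

variable [Group G] [LieGroup 𝓘(ℝ, E) ∞ G]

theorem HasVelocityAt.hasDerivAt_chart {g : ℝ → G} {t : ℝ} {u : GroupLieAlgebra 𝓘(ℝ, E) G}
    (hg : HasVelocityAt g t (dLeft (g t) u)) {q₀ : G}
    (hq : g t ∈ (extChartAt 𝓘(ℝ, E) q₀).source) :
    HasDerivAt (fun τ => extChartAt 𝓘(ℝ, E) q₀ (g τ))
      (leftFieldCoord E q₀ (extChartAt 𝓘(ℝ, E) q₀ (g t)) u) t := by
  have h := hg.hasDerivAt_comp (hasMFDerivAt_chart hq)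
  rw [leftFieldCoord, (extChartAt 𝓘(ℝ, E) q₀).left_inv hq]
  exact h

/-- Formally the derivative is `a ψ(Ad(g)[w, w]) = 0`. In the chart it is `a` times
`lieDeriv_rightForm` with both arguments taken along the field of `w`. -/
theorem HasVelocityAt.hasDerivAt_adDual {g : ℝ → G} {t : ℝ} (ψ : E →L[ℝ] ℝ) (a : ℝ)
    (w : GroupLieAlgebra 𝓘(ℝ, E) G) (hg : HasVelocityAt g t (dLeft (g t) (a • w)))
    (hcont : ContinuousAt g t) :
    HasDerivAt (fun τ => adDual ψ (g τ) w) 0 t := by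
  have hq := mem_extChartAt_source (I := 𝓘(ℝ, E)) (g t)
  have hz := (extChartAt 𝓘(ℝ, E) (g t)).map_source hq
  have hx := hg.hasDerivAt_chart hq
  set z := extChartAt 𝓘(ℝ, E) (g t) (g t) with hzdef
  have h1 := ((contDiffAt_rightFormCoord ψ hz).differentiableAt (by simp)).hasFDerivAt
  have h2 : HasFDerivAt (fun y => leftFieldCoord E (g t) y w) _ z :=
    (((contDiffAt_leftFieldCoord hz).differentiableAt (by simp)).clm_apply
      (differentiableAt_const (w : E))).hasFDerivAt
  have h3 := (h1.clm_apply h2).comp_hasDerivAt_of_eq t hx hzdef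
  have h4 := lieDeriv_rightForm ψ hz w (leftFieldCoord E (g t) z w)
  have h5 : leftFieldCoord E (g t) z (a • w) = a • leftFieldCoord E (g t) z w :=
    (leftFieldCoord E (g t) z).map_smul a w
  rw [h5] at h3
  have h6 : (fun τ => adDual ψ (g τ) w) =ᶠ[𝓝 t]
      (fun y => rightFormCoord ψ (g t) y (leftFieldCoord E (g t) y w)) ∘
        fun τ => extChartAt 𝓘(ℝ, E) (g t) (g τ) := by
    filter_upwards [hcont.preimage_mem_nhds ((isOpen_extChartAt_source (g t)).mem_nhds hq)]
      with τ hτ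
    exact congrArg (fun L : E →L[ℝ] ℝ => L w) (adDual_eq_coord ψ hτ)
  refine (h3.congr_of_eventuallyEq h6).congr_deriv ?_
  simp only [add_apply, ContinuousLinearMap.comp_apply,
    ContinuousLinearMap.flip_apply, map_smul, smul_eq_mul]
  linear_combination a * h4

/-- In coordinates `H` is the pairing of `y` with the left-invariant field of `u`. It is linear in
`y`, so the first equation is the velocity equation; the second is `lieDeriv_rightForm`. -/
theorem HasVelocityAt.hamiltonEquationsAt {g : ℝ → G} {t : ℝ} (ψ : E →L[ℝ] ℝ)
    {u : ℝ → GroupLieAlgebra 𝓘(ℝ, E) G} (hg : HasVelocityAt g t (dLeft (g t) (u t)))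
    (hcont : ContinuousAt g t) {q₀ : G} (hq : g t ∈ (extChartAt 𝓘(ℝ, E) q₀).source) :
    HamiltonEquationsAt g (fun t => rightForm (E := E) ψ (g t)) u q₀ t := by
  have hz := (extChartAt 𝓘(ℝ, E) q₀).map_source hq
  have hx := hg.hasDerivAt_chart hq
  have hy : (fun τ => covectorCoord q₀ (g τ) (rightForm (E := E) ψ (g τ))) =ᶠ[𝓝 t]
      fun τ => rightFormCoord ψ q₀ (extChartAt 𝓘(ℝ, E) q₀ (g τ)) := by
    filter_upwards [hcont.preimage_mem_nhds ((isOpen_extChartAt_source q₀).mem_nhds hq)]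
      with τ hτ
    rw [rightFormCoord, (extChartAt 𝓘(ℝ, E) q₀).left_inv hτ]
    rfl
  refine ⟨⟨_, hx, fun η => ?_⟩, ?_⟩
  · exact (congrArg (fun L : (E →L[ℝ] ℝ) →L[ℝ] ℝ => L η) (ContinuousLinearMap.fderiv
      (ContinuousLinearMap.apply ℝ ℝ
        (leftFieldCoord E q₀ (extChartAt 𝓘(ℝ, E) q₀ (g t)) (u t))))).symm
  · set z := extChartAt 𝓘(ℝ, E) q₀ (g t) with hzdef
    have h1 := ((contDiffAt_rightFormCoord ψ hz).differentiableAt (by simp)).hasFDerivAt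
    have h2 := (h1.comp_hasDerivAt_of_eq t hx hzdef).congr_of_eventuallyEq hy
    refine h2.congr_deriv ?_
    have hyt : covectorCoord q₀ (g t) (rightForm (E := E) ψ (g t)) = rightFormCoord ψ q₀ z :=
      hy.self_of_nhds
    have h3 : HasFDerivAt (fun y => leftFieldCoord E q₀ y (u t)) _ z :=
      (((contDiffAt_leftFieldCoord hz).differentiableAt (by simp)).clm_apply
        (differentiableAt_const (u t : E))).hasFDerivAt
    have h4 : fderiv ℝ (fun y => hamiltonianCoord q₀ (u t) y
        (covectorCoord q₀ (g t) (rightForm (E := E) ψ (g t)))) z =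
        (rightFormCoord ψ q₀ z).comp (fderiv ℝ (fun y => leftFieldCoord E q₀ y (u t)) z) := by
      rw [hyt]
      exact ((rightFormCoord ψ q₀ z).hasFDerivAt.comp z h3).fderiv
    refine ContinuousLinearMap.ext fun η => ?_
    rw [h4]
    have h5 := lieDeriv_rightForm ψ hz (u t) η
    simp only [neg_apply, ContinuousLinearMap.comp_apply]
    linarith

theorem LocallyLipschitzCurve.locallyLipschitz_adDual {g : ℝ → G}
    (hg : LocallyLipschitzCurve E g) (ψ : E →L[ℝ] ℝ) :
    LocallyLipschitz fun t => adDual ψ (g t) := by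
  intro t
  obtain ⟨hcont, K, S, hS, hK⟩ := hg t
  have hq := mem_extChartAt_source (I := 𝓘(ℝ, E)) (g t)
  have hz := (extChartAt 𝓘(ℝ, E) (g t)).map_source hq
  obtain ⟨K', S', hS', hK'⟩ := ((contDiffAt_rightFormCoord ψ hz).clm_comp
    (contDiffAt_leftFieldCoord hz)).exists_lipschitzOnWith
  have hx : ContinuousAt (fun τ => extChartAt 𝓘(ℝ, E) (g t) (g τ)) t :=
    (contMDiffAt_chart hq).continuousAt.comp hcont
  refine ⟨K' * K, S ∩ (fun τ => extChartAt 𝓘(ℝ, E) (g t) (g τ)) ⁻¹' S' ∩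
    g ⁻¹' (extChartAt 𝓘(ℝ, E) (g t)).source, inter_mem (inter_mem hS (hx.preimage_mem_nhds hS'))
    (hcont.preimage_mem_nhds ((isOpen_extChartAt_source (g t)).mem_nhds hq)), ?_⟩
  have h := hK'.comp (hK.mono (inter_subset_left.trans inter_subset_left :
    S ∩ (fun τ => extChartAt 𝓘(ℝ, E) (g t) (g τ)) ⁻¹' S' ∩
      g ⁻¹' (extChartAt 𝓘(ℝ, E) (g t)).source ⊆ S)) (fun τ hτ => hτ.1.2)
  intro x hx y hy
  beta_reduce
  rw [adDual_eq_coord ψ hx.2, adDual_eq_coord ψ hy.2]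
  exact h hx hy

theorem absolutelyContinuousOnInterval_of_locallyLipschitz {F : Type*} [NormedAddCommGroup F]
    {f : ℝ → F} (hf : LocallyLipschitz f) (a b : ℝ) : AbsolutelyContinuousOnInterval f a b := by
  obtain ⟨K, hK⟩ := (hf.locallyLipschitzOn (s := uIcc a b)).exists_lipschitzOnWith_of_compact
    isCompact_uIcc
  exact hK.absolutelyContinuousOnInterval

/-- A control of a continuous trajectory is measurable. -/
theorem aestronglyMeasurable_of_hasVelocityAt [FiniteDimensional ℝ E] {g : ℝ → G}
    (hcont : Continuous g) {u : ℝ → GroupLieAlgebra 𝓘(ℝ, E) G}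
    (hg : ∀ᵐ t, HasVelocityAt g t (dLeft (g t) (u t))) : AEStronglyMeasurable u volume := by
  have : IsTopologicalGroup G := topologicalGroup_of_lieGroup 𝓘(ℝ, E) ∞
  let χ : G → E := extChartAt 𝓘(ℝ, E) (1 : G)
  let S : ℕ → Set ℝ := fun n =>
    {t | (g t)⁻¹ * g (t + ((n : ℝ) + 1)⁻¹) ∈ (extChartAt 𝓘(ℝ, E) (1 : G)).source}
  have hmulcont (n : ℕ) : Continuous fun t => (g t)⁻¹ * g (t + ((n : ℝ) + 1)⁻¹) := by fun_prop
  have hS (n : ℕ) : IsOpen (S n) := (isOpen_extChartAt_source (1 : G)).preimage (hmulcont n)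
  -- Difference quotients of the curve shifted back to the unit, set to zero where the chart at the
  -- unit is not available. They converge to `u t` at almost every `t`.
  let f : ℕ → ℝ → E := fun n => (S n).indicator fun t =>
    ((n : ℝ) + 1) • (χ ((g t)⁻¹ * g (t + ((n : ℝ) + 1)⁻¹)) - χ 1)
  have hf (n : ℕ) : AEStronglyMeasurable (f n) volume := by
    refine (aestronglyMeasurable_indicator_iff (hS n).measurableSet).2 ?_
    refine ContinuousOn.aestronglyMeasurable ?_ (hS n).measurableSet
    refine continuousOn_const.smul (ContinuousOn.sub ?_ continuousOn_const)
    exact (continuousOn_extChartAt (I := 𝓘(ℝ, E)) (1 : G)).comp (hmulcont n).continuousOn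
      fun t ht => ht
  have hlim : ∀ᵐ t, Tendsto (fun n => f n t) atTop (𝓝 (show E from u t)) := by
    filter_upwards [hg] with t ht
    have hd : HasDerivAt (fun τ => χ ((g t)⁻¹ * g τ)) (show E from u t) t := by
      obtain ⟨L, hL₁, hL₂⟩ : ∃ L : E →L[ℝ] E, HasMFDerivAt 𝓘(ℝ, E) 𝓘(ℝ, E)
          (fun h : G => (g t)⁻¹ * h) (g t) L ∧ ∀ v : E, L (leftDeriv E (g t) v) = v :=
        ⟨_, hasMFDerivAt_leftInv (E := E) (g t), dLeftInv_dLeft (g t)⟩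
      have hL := hasMFDerivAt_comp_of_eq
        (hasMFDerivAt_chart (mem_extChartAt_source (I := 𝓘(ℝ, E)) (1 : G)))
        hL₁ (inv_mul_cancel (g t))
      rw [chartDeriv_self, ContinuousLinearMap.id_comp] at hL
      exact (ht.hasDerivAt_comp hL).congr_deriv (hL₂ (u t))
    have hseq : Tendsto (fun n : ℕ => ((n : ℝ) + 1)⁻¹) atTop (𝓝[≠] 0) := by
      refine tendsto_nhdsWithin_iff.2 ⟨?_, Eventually.of_forall fun n => ?_⟩
      · simpa using tendsto_one_div_add_atTop_nhds_zero_nat (𝕜 := ℝ)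
      · have : (0 : ℝ) < (n : ℝ) + 1 := by positivity
        exact (inv_pos.2 this).ne'
    refine ((hasDerivAt_iff_tendsto_slope_zero.1 hd).comp hseq).congr' ?_
    have hmem : ∀ᶠ n : ℕ in atTop, t ∈ S n := by
      have hc : ContinuousAt (fun r : ℝ => (g t)⁻¹ * g (t + r)) 0 := by fun_prop
      refine (hseq.mono_right nhdsWithin_le_nhds).eventually (hc.preimage_mem_nhds
        ((isOpen_extChartAt_source (1 : G)).mem_nhds ?_))
      simp
    filter_upwards [hmem] with n hn
    simp [f, indicator_of_mem hn]
  exact aestronglyMeasurable_of_tendsto_ae (β := E) atTop hf hlim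

end Curves

/-- With `F` as the norm of `V`, every linear map from the finite-dimensional space `V` is bounded.
Applied to the inclusion of `p`, this bounds `U`. -/
theorem exists_norm_le_seminorm {V E : Type*} [AddCommGroup V] [Module ℝ V]
    [FiniteDimensional ℝ V] [NormedAddCommGroup E] [NormedSpace ℝ E] (F : Seminorm ℝ V)
    (hF : ∀ x, F x = 0 → x = 0) (f : V →ₗ[ℝ] E) : ∃ C : ℝ≥0, ∀ x, ‖f x‖ ≤ C * F x := by
  let _ : Norm V := ⟨F⟩
  have core : NormedSpace.Core ℝ V :=
    { norm_nonneg := fun x => apply_nonneg F x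
      norm_smul := fun c x => map_smul_eq_mul F c x
      norm_triangle := fun x y => map_add_le_add F x y
      norm_eq_zero_iff := fun x => ⟨hF x, fun h => by subst h; exact map_zero F⟩ }
  let _ : NormedAddCommGroup V := NormedAddCommGroup.ofCore core
  let _ : NormedSpace ℝ V := NormedSpace.ofCore core
  exact ⟨‖LinearMap.toContinuousLinearMap f‖₊, (LinearMap.toContinuousLinearMap f).le_opNorm⟩

/-! ### The maximized Hamiltonian, normal extremals and length. -/

section Metric

variable {E : Type*} [NormedAddCommGroup E] [NormedSpace ℝ E]
  {G : Type*} [TopologicalSpace G] [ChartedSpace E G] [Group G]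

namespace LeftInvariantMetric

theorem zero_mem_U (d : LeftInvariantMetric E G) : (0 : GroupLieAlgebra 𝓘(ℝ, E) G) ∈ d.U :=
  ⟨d.p.zero_mem, by
    have : (⟨0, d.p.zero_mem⟩ : d.p) = 0 := rfl
    rw [this, map_zero]; exact zero_le_one⟩

theorem tnorm_eq (d : LeftInvariantMetric E G) {q : G} {X : TangentSpace 𝓘(ℝ, E) q}
    {u : GroupLieAlgebra 𝓘(ℝ, E) G} (hX : dLeftInv q X = u) (hu : u ∈ d.p) :
    d.tnorm q X = ENNReal.ofReal (d.F ⟨u, hu⟩) := by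
  subst hX
  exact dif_pos hu

theorem exists_norm_le_of_mem_U [FiniteDimensional ℝ E] (d : LeftInvariantMetric E G) :
    ∃ C : ℝ≥0, ∀ u : E, u ∈ d.U → ‖u‖ ≤ C := by
  have : FiniteDimensional ℝ (GroupLieAlgebra 𝓘(ℝ, E) G) := inferInstanceAs (FiniteDimensional ℝ E)
  obtain ⟨C, hC⟩ := exists_norm_le_seminorm (E := E) d.F d.eq_zero_of_F_eq_zero d.p.subtype
  refine ⟨C, fun u ⟨hu, hu'⟩ => (hC ⟨u, hu⟩).trans ?_⟩
  exact mul_le_of_le_one_right C.2 hu'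

end LeftInvariantMetric

namespace IsMaximalSelection

variable {d : LeftInvariantMetric E G} {ψ₀ : GroupLieAlgebra 𝓘(ℝ, E) G →L[ℝ] ℝ}
  {w : G → GroupLieAlgebra 𝓘(ℝ, E) G}

theorem max_nonneg (hw : IsMaximalSelection d ψ₀ w) (q : G) : 0 ≤ ψ₀ (Ad q (w q)) := by
  simpa using (hw q).2 0 d.zero_mem_U

/-- A positive maximum of a linear functional on the unit ball is attained only on the sphere:
otherwise rescaling the maximizer to norm one would increase the value. -/
theorem F_eq_one (hw : IsMaximalSelection d ψ₀ w) {q : G} (hq : 0 < ψ₀ (Ad q (w q))) :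
    ∃ h : w q ∈ d.p, d.F ⟨w q, h⟩ = 1 := by
  obtain ⟨⟨hp, hF⟩, hmax⟩ := hw q
  refine ⟨hp, le_antisymm hF ?_⟩
  have hpos : 0 < d.F ⟨w q, hp⟩ := by
    refine lt_of_le_of_ne (apply_nonneg _ _) fun h => ?_
    have h0 : w q = 0 := congrArg Subtype.val (d.eq_zero_of_F_eq_zero _ h.symm)
    rw [h0] at hq
    simp at hq
  have hmem : (d.F ⟨w q, hp⟩)⁻¹ • w q ∈ d.U := by
    refine ⟨d.p.smul_mem _ hp, ?_⟩
    have : (⟨(d.F ⟨w q, hp⟩)⁻¹ • w q, d.p.smul_mem _ hp⟩ : d.p) =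
      (d.F ⟨w q, hp⟩)⁻¹ • ⟨w q, hp⟩ := rfl
    rw [this, map_smul_eq_mul, Real.norm_of_nonneg (inv_nonneg.2 hpos.le),
      inv_mul_cancel₀ hpos.ne']
  have h := hmax _ hmem
  rw [map_smul, map_smul, smul_eq_mul] at h
  have h1 : (d.F ⟨w q, hp⟩)⁻¹ ≤ 1 := by
    by_contra! hlt
    nlinarith
  exact (inv_le_one₀ hpos).1 h1

variable [LieGroup 𝓘(ℝ, E) ∞ G]

theorem tnorm_geodesicField (hw : IsMaximalSelection d ψ₀ w) {q : G}
    (hq : 0 < ψ₀ (Ad q (w q))) :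
    d.tnorm q (geodesicField ψ₀ w q) = ENNReal.ofReal (ψ₀ (Ad q (w q))) := by
  obtain ⟨hp, hF⟩ := hw.F_eq_one hq
  have hmem : ψ₀ (Ad q (w q)) • w q ∈ d.p := d.p.smul_mem _ hp
  have h1 : d.F ⟨ψ₀ (Ad q (w q)) • w q, hmem⟩ = ψ₀ (Ad q (w q)) := by
    have : (⟨ψ₀ (Ad q (w q)) • w q, hmem⟩ : d.p) = ψ₀ (Ad q (w q)) • ⟨w q, hp⟩ := rfl
    rw [this, map_smul_eq_mul, Real.norm_of_nonneg hq.le, hF, mul_one]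
  exact (d.tnorm_eq (dLeftInv_dLeft q _) hmem).trans (congrArg ENNReal.ofReal h1)

/-- The maximum of the Hamiltonian is constant along the integral curves of the geodesic field. -/
theorem max_const [FiniteDimensional ℝ E] (hw : IsMaximalSelection d ψ₀ w) {g : ℝ → G}
    (hg : IsIntegralCurve (geodesicField ψ₀ w) g) (t : ℝ) :
    ψ₀ (Ad (g t) (w (g t))) = ψ₀ (Ad (g 0) (w (g 0))) := by
  obtain ⟨C, hC⟩ := d.exists_norm_le_of_mem_U
  let P : G → E →L[ℝ] ℝ := adDual (show E →L[ℝ] ℝ from ψ₀)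
  let k : ℝ → ℝ := fun t => P (g t) (w (g t))
  have hmax (q q' : G) : P q (w q') ≤ P q (w q) := (hw q).2 _ (hw q').1
  have hP : LocallyLipschitz fun t => P (g t) := hg.locallyLipschitz.locallyLipschitz_adDual _
  -- The maximizer at `g x` is a competitor at `g y`, so no regularity of `w` is needed.
  have hle (x y : ℝ) : k x - k y ≤ C * ‖P (g x) - P (g y)‖ := by
    have h1 := hmax (g y) (g x)
    have h2 : P (g x) (w (g x)) - P (g y) (w (g x)) ≤ ‖P (g x) - P (g y)‖ * C :=
      (le_abs_self _).trans (((P (g x) - P (g y)).le_opNorm (w (g x))).trans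
        (mul_le_mul_of_nonneg_left (hC _ (hw (g x)).1) (norm_nonneg _)))
    linarith
  have hk : LocallyLipschitz k := by
    intro t
    obtain ⟨K, S, hS, hK⟩ := hP t
    refine ⟨C * K, S, hS, LipschitzOnWith.of_dist_le_mul fun x hx y hy => ?_⟩
    have h1 : ‖P (g x) - P (g y)‖ ≤ K * dist x y := by
      rw [← dist_eq_norm]; exact hK.dist_le_mul x hx y hy
    have h2 : C * ‖P (g x) - P (g y)‖ ≤ (C * K : ℝ≥0) * dist x y := by
      rw [NNReal.coe_mul, mul_assoc]
      exact mul_le_mul_of_nonneg_left h1 C.2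
    rw [Real.dist_eq]
    refine abs_sub_le_iff.2 ⟨(hle x y).trans h2, (hle y x).trans ?_⟩
    rwa [norm_sub_rev]
  have hac := absolutelyContinuousOnInterval_of_locallyLipschitz hk 0 t
  obtain ⟨c, hc⟩ := hac.const_of_ae_hasDerivAt_zero (by
    filter_upwards [hac.boundedVariationOn.ae_differentiableAt_of_mem_uIcc, hg.velocity]
      with s hs hv hmem
    have h1 : HasDerivAt (fun τ => P (g τ) (w (g s))) 0 s :=
      hv.hasDerivAt_adDual _ _ _ (hg.locallyLipschitz s).1
    have h2 := (hs hmem).hasDerivAt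
    -- With the maximizer frozen at time `s`, the difference is nonnegative and vanishes at `τ = s`;
    -- hence `k` and the comparison function have the same derivative there.
    have h3 : IsLocalMin (fun τ => k τ - P (g τ) (w (g s))) s := by
      refine Eventually.of_forall fun τ => ?_
      have := hmax (g τ) (g s)
      simp only [k, sub_self]
      linarith
    have h4 := h3.hasDerivAt_eq_zero (h2.sub h1)
    rw [sub_zero] at h4
    rwa [h4] at h2)
  exact (hc t right_mem_uIcc).trans (hc 0 left_mem_uIcc).symm

end IsMaximalSelection

theorem ae_comp_div {P : ℝ → Prop} (h : ∀ᵐ t, P t) {c : ℝ} (hc : c ≠ 0) :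
    ∀ᵐ s : ℝ, P (s / c) := by
  have hq : Measure.QuasiMeasurePreserving (fun s : ℝ => s / c) volume volume := by
    refine ⟨by fun_prop, ?_⟩
    simp only [div_eq_mul_inv]
    rw [Real.map_volume_mul_right (inv_ne_zero hc)]
    exact Measure.smul_absolutelyContinuous
  exact hq.ae h

variable [LieGroup 𝓘(ℝ, E) ∞ G]

theorem IsIntegralCurve.isNormalExtremal [FiniteDimensional ℝ E] {d : LeftInvariantMetric E G}
    {ψ₀ : GroupLieAlgebra 𝓘(ℝ, E) G →L[ℝ] ℝ} {w : G → GroupLieAlgebra 𝓘(ℝ, E) G}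
    (hw : IsMaximalSelection d ψ₀ w) {g : ℝ → G}
    (hg : IsIntegralCurve (geodesicField ψ₀ w) g) {c : ℝ} (hc : 0 < c)
    (hmax : ∀ t, ψ₀ (Ad (g t) (w (g t))) = c) :
    IsNormalExtremal d fun s => g (s / c) := by
  let ψ : E →L[ℝ] ℝ := ψ₀
  have hlip := hg.locallyLipschitz.comp_div c
  have hvel : ∀ᵐ s, HasVelocityAt (E := E) (fun s => g (s / c)) s
      (dLeft (g (s / c)) (w (g (s / c)))) := by
    filter_upwards [ae_comp_div hg.velocity hc.ne'] with s hs
    have h := hs.comp_div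
    -- The factor `c` of the geodesic field cancels the time change, so the control is `w` itself, a
    -- point of `U`.
    have h1 : c⁻¹ • leftDeriv E (g (s / c)) (c • w (g (s / c))) =
        leftDeriv E (g (s / c)) (w (g (s / c))) := by
      have h2 : leftDeriv E (g (s / c)) (c • w (g (s / c))) =
          c • leftDeriv E (g (s / c)) (w (g (s / c))) := (leftDeriv E (g (s / c))).map_smul c _
      rw [h2, inv_smul_smul₀ hc.ne']
    have h3 : geodesicField ψ₀ w (g (s / c)) = leftDeriv E (g (s / c)) (c • w (g (s / c))) := by
      rw [geodesicField, hmax]; rfl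
    rw [h3, h1] at h
    exact h
  have hham (q : G) (u : GroupLieAlgebra 𝓘(ℝ, E) G) :
      hamiltonian q (rightForm (E := E) ψ q) u = ψ₀ (Ad q u) :=
    (congrArg (fun L : E →L[ℝ] ℝ => L u) (adDual_eq ψ q)).symm
  refine ⟨fun s => w (g (s / c)), fun s => rightForm (E := E) ψ (g (s / c)), c, hc,
    ⟨hlip, ?_, fun s => (hw _).1, ?_, ?_, ?_, ?_⟩, ?_⟩
  · exact aestronglyMeasurable_of_hasVelocityAt hlip.continuous hvel
  · intro v a b
    have h : LocallyLipschitz fun s => adDual ψ (g (s / c)) v :=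
      (ContinuousLinearMap.apply ℝ ℝ (show E from v)).lipschitz.locallyLipschitz.comp
        (hlip.locallyLipschitz_adDual ψ)
    have h' : (fun s => rightForm (E := E) ψ (g (s / c)) (dLeft (g (s / c)) v)) =
        fun s => adDual ψ (g (s / c)) v := funext fun s => hham (g (s / c)) v
    have hac := absolutelyContinuousOnInterval_of_locallyLipschitz h a b
    rw [← h'] at hac
    exact hac
  -- A zero covector would give the Hamiltonian the value zero instead of `c`.
  · intro s hs
    have h1 := hham (g (s / c)) (w (g (s / c)))
    rw [hmax, hs] at h1
    exact hc.ne h1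
  · intro q₀
    filter_upwards [hvel] with s hs hq
    exact HasVelocityAt.hamiltonEquationsAt (g := fun s => g (s / c))
      (u := fun s => w (g (s / c))) ψ hs (hlip s).1 hq
  · refine Eventually.of_forall fun s u hu => ?_
    rw [hham, hham]
    exact (hw _).2 u hu
  · exact Eventually.of_forall fun s => (hham _ _).trans (hmax _)

theorem IsIntegralCurve.length_eq {d : LeftInvariantMetric E G}
    {ψ₀ : GroupLieAlgebra 𝓘(ℝ, E) G →L[ℝ] ℝ} {w : G → GroupLieAlgebra 𝓘(ℝ, E) G}
    (hw : IsMaximalSelection d ψ₀ w) {g : ℝ → G}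
    (hg : IsIntegralCurve (geodesicField ψ₀ w) g) {c : ℝ} (hc : 0 < c)
    (hmax : ∀ t, ψ₀ (Ad (g t) (w (g t))) = c) (a b : ℝ) :
    d.length g a b = ENNReal.ofReal (c * (b - a)) := by
  have h : ∀ᵐ t, d.tnorm (g t) (mfderiv 𝓘(ℝ, ℝ) 𝓘(ℝ, E) g t (1 : ℝ)) = ENNReal.ofReal c := by
    filter_upwards [hg.velocity] with t ht
    have h1 : mfderiv 𝓘(ℝ, ℝ) 𝓘(ℝ, E) g t (1 : ℝ) = geodesicField ψ₀ w (g t) := by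
      rw [HasMFDerivAt.mfderiv ht]
      exact one_smul ℝ (geodesicField ψ₀ w (g t))
    rw [h1, hw.tnorm_geodesicField (by rwa [hmax]), hmax]
  rw [LeftInvariantMetric.length, lintegral_congr_ae (ae_restrict_of_ae h), setLIntegral_const,
    Real.volume_Icc, ENNReal.ofReal_mul hc.le]

end Metric

end SubFinsler

end

theorem theorem4 {E : Type*} [NormedAddCommGroup E] [NormedSpace ℝ E] [FiniteDimensional ℝ E]
    {G : Type*} [TopologicalSpace G] [ChartedSpace E G] [Group G] [LieGroup 𝓘(ℝ, E) ∞ G]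
    [ConnectedSpace G]
    (d : SubFinsler.LeftInvariantMetric E G)
    (ψ₀ : GroupLieAlgebra 𝓘(ℝ, E) G →L[ℝ] ℝ) (hψ₀ : IsGreatest (ψ₀ '' d.U) 1)
    (w : G → GroupLieAlgebra 𝓘(ℝ, E) G) (hw : SubFinsler.IsMaximalSelection d ψ₀ w)
    (g₀ : G) (hg₀ : SubFinsler.geodesicField ψ₀ w g₀ ≠ 0)
    (g : ℝ → G) (hg : SubFinsler.IsIntegralCurve (SubFinsler.geodesicField ψ₀ w) g)
    (hg0 : g 0 = g₀) :
    ∃ c : ℝ, 0 < c ∧ d.tnorm g₀ (SubFinsler.geodesicField ψ₀ w g₀) = ENNReal.ofReal c ∧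
      SubFinsler.IsNormalExtremal d (fun s : ℝ => g (s / c)) ∧
      ∀ a b : ℝ, a ≤ b → d.length g a b = ENNReal.ofReal (c * (b - a)) := by
  -- The maximum is nonnegative since `0 ∈ U`, and if it were zero the geodesic field would vanish
  -- at `g₀`.
  have hpos : 0 < ψ₀ (SubFinsler.Ad g₀ (w g₀)) := by
    refine lt_of_le_of_ne (hw.max_nonneg g₀) fun h => hg₀ ?_
    rw [SubFinsler.geodesicField, ← h, zero_smul, map_zero]
  have hmax (t : ℝ) : ψ₀ (SubFinsler.Ad (g t) (w (g t))) = ψ₀ (SubFinsler.Ad g₀ (w g₀)) := by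
    rw [hw.max_const hg t, hg0]
  exact ⟨_, hpos, hw.tnorm_geodesicField hpos, hg.isNormalExtremal hw hpos hmax,
    fun a b _ => hg.length_eq hw hpos hmax a b⟩
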